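/- **Notation.** Let $q\ge 1$ be an integer, $\alpha\in\mathbb R$, and write $A^\dagger$ for the Moore–Penrose inverse of a complex matrix $A$. All sequences $(s_j)_{j=0}^{\kappa}$, $\kappa\in\{0,1,2,\dots\}\cup\{\infty\}$, consist of complex $q\times q$ matrices. Put $H_n=[s_{j+k}]_{j,k=0}^{n}$ (a block Hankel matrix, defined when $2n\le\kappa$) and, if $\kappa\ge1$, let $v_j=-\alpha s_j+s_{j+1}$ for $0\le j\le\kappa-1$, with block Hankel matrices $H_n^{(\alpha)}=[v_{j+k}]_{j,k=0}^{n}$ (defined when $2n+1\le\kappa$). Put $$L_0=s_0,\qquad L_n=s_{2n}-[s_n,\dots,s_{2n-1}]\,H_{n-1}^\dagger\begin{bmatrix}s_n\\ \vdots\\ s_{2n-1}\end{bmatrix}\quad(n\ge1,\ 2n\le\kappa),$$ and let $L_n^{(\alpha)}$ (defined when $2n+1\le\kappa$) be the matrix built in the same way from $(v_j)_{j=0}^{\kappa-1}$. **Classes.** * $K^{\ge}_m$ for finite $m\geq 0$: $(s_j)_{j=0}^m\in K^{\ge}_m$ iff $H_{\lfloor m/2\rfloor}$ and, if $m\ge1$,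 also $H^{(\alpha)}_{\lfloor (m-1)/2\rfloor}$ are nonnegative Hermitian. $K^{\ge}_\infty$ is the set of all infinite sequences with $(s_j)_{j=0}^m\in K^{\ge}_m$ for all $m$. * $K^{>}_\kappa$: defined in the same way, with "positive definite Hermitian" in place of "nonnegative Hermitian". * $K^{\ge,e}_m$ for finite $m$: the set of all $(s_j)_{j=0}^m$ for which there is a matrix $s_{m+1}$ with $(s_j)_{j=0}^{m+1}\in K^{\ge}_{m+1}$; and $K^{\ge,e}_\infty=K^{\ge}_\infty$. * $K^{\ge,cd}_{2n}=\{(s_j)_{j=0}^{2n}\in K^{\ge}_{2n}: L_n=0\}$ and $K^{\ge,cd}_{2n+1}=\{(s_j)_{j=0}^{2n+1}\in K^{\ge}_{2n+1}: L^{(\alpha)}_n=0\}$ for $n\ge0$; $K^{\ge,cd}_\infty$ is the set of all $(s_j)_{j=0}^\infty\in K^{\ge}_\infty$ such that $(s_j)_{j=0}^m\in K^{\ge,cd}_m$ for some finite $m\geq 0$. * $K^{\ge,cd_m}_\kappa=\{(s_j)_{j=0}^\kappa\in K^{\ge}_\kappa: (s_j)_{j=0}^m\in K^{\ge,cd}_m\}$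 for integers $0\le m\le\kappa$. **Transform.** Let $\kappa\ge1$. Put $u_0=s_0$ and $u_j=-\alpha s_{j-1}+s_j$ for $1\le j\le\kappa$. Let $u_0^\sharp=u_0^\dagger$ and $u_j^\sharp=-u_0^\dagger\sum_{l=0}^{j-1}u_{j-l}u_l^\sharp$ for $1\le j\le\kappa$. The first $\alpha$-Schur–Stieltjes transform of $(s_j)_{j=0}^\kappa$ is the sequence $$s_j^{[1,\alpha]}=-\,s_0\,u_{j+1}^\sharp\,s_0\qquad(0\le j\le\kappa-1),$$ where $\infty-1=\infty$. **Theorem P1546.** Let $\alpha\in\mathbb R$, let $\kappa\in\{1,2,\dots\}\cup\{\infty\}$, and let $(s_j)_{j=0}^\kappa$ be a sequence of complex $q\times q$ matrices. Then: 1. If $(s_j)_{j=0}^\kappa\in K^{\ge}_\kappa$, then $(s_j^{[1,\alpha]})_{j=0}^{\kappa-1}\in K^{\ge}_{\kappa-1}$. 2. If $(s_j)_{j=0}^\kappa\in K^{\ge,e}_\kappa$, then $(s_j^{[1,\alpha]})_{j=0}^{\kappa-1}\in K^{\ge,e}_{\kappa-1}$. 3. If $(s_j)_{j=0}^\kappa\in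 K^{>}_\kappa$, then $(s_j^{[1,\alpha]})_{j=0}^{\kappa-1}\in K^{>}_{\kappa-1}$. 4. If $m$ is an integer with $0\le m\le\kappa$ and $(s_j)_{j=0}^\kappa\in K^{\ge,cd_m}_\kappa$, then $(s_j^{[1,\alpha]})_{j=0}^{\kappa-1}\in K^{\ge,cd_{\max\{0,m-1\}}}_{\kappa-1}$. 5. If $(s_j)_{j=0}^\kappa\in K^{\ge,cd}_\kappa$, then $(s_j^{[1,\alpha]})_{j=0}^{\kappa-1}\in K^{\ge,cd}_{\kappa-1}$. -/

import Mathlib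

namespace StieltjesSeq

section MoorePenrose

open Matrix
open scoped ComplexOrder

variable {m n : Type*} [Fintype m] [Fintype n]

/-- The four Penrose equations: `B` is the Moore-Penrose inverse of the complex matrix `A`. -/
structure IsMoorePenrose (A : Matrix m n ℂ) (B : Matrix n m ℂ) : Prop where
  mul_mul_self : A * B * A = A
  self_mul_mul : B * A * B = B
  isHermitian_left : (A * B).IsHermitian
  isHermitian_right : (B * A).IsHermitian

theorem IsMoorePenrose.unique {A : Matrix m n ℂ} {B C : Matrix n m ℂ}
    (hB : IsMoorePenrose A B) (hC : IsMoorePenrose A C) : B = C := by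
  have h1 : A * B = A * C := by
    have e : A * C * (A * B) = A * B := by
      rw [← Matrix.mul_assoc, hC.mul_mul_self]
    have e' : A * B * (A * C) = A * C := by
      rw [← Matrix.mul_assoc, hB.mul_mul_self]
    have := congrArg conjTranspose e
    rw [conjTranspose_mul, hB.isHermitian_left, hC.isHermitian_left, e'] at this
    exact this.symm
  have h2 : B * A = C * A := by
    have e : B * A * (C * A) = B * A := by
      rw [Matrix.mul_assoc, ← Matrix.mul_assoc A, hC.mul_mul_self]
    have e' : C * A * (B * A) = C * A := by
      rw [Matrix.mul_assoc, ← Matrix.mul_assoc A, hB.mul_mul_self]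
    have := congrArg conjTranspose e
    rw [conjTranspose_mul, hB.isHermitian_right, hC.isHermitian_right, e'] at this
    exact this.symm
  calc B = B * A * B := hB.self_mul_mul.symm
    _ = C * A * C := by rw [h2, Matrix.mul_assoc, h1, ← Matrix.mul_assoc]
    _ = C := hC.self_mul_mul

theorem exists_hermitian_generalizedInverse [DecidableEq n] {G : Matrix n n ℂ}
    (hG : G.IsHermitian) :
    ∃ X : Matrix n n ℂ, G * X * G = G ∧ X * G * X = X ∧ Xᴴ = X ∧ G * X = X * G := by
  let U : Matrix n n ℂ := hG.eigenvectorUnitary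
  let d : n → ℂ := fun i => (hG.eigenvalues i : ℂ)
  have hU : star U * U = 1 := Unitary.coe_star_mul_self hG.eigenvectorUnitary
  have hGU : G = U * diagonal d * star U := by
    have h := hG.spectral_theorem
    rw [Unitary.conjStarAlgAut_apply] at h
    exact h
  have key : ∀ v w : n → ℂ, (U * diagonal v * star U) * (U * diagonal w * star U) =
      U * diagonal (fun i => v i * w i) * star U := by
    intro v w
    calc (U * diagonal v * star U) * (U * diagonal w * star U)
        = U * diagonal v * (star U * U) * diagonal w * star U := by
          simp only [Matrix.mul_assoc]
      _ = U * diagonal (fun i => v i * w i) * star U := by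
          rw [hU, Matrix.mul_one, Matrix.mul_assoc U, diagonal_mul_diagonal]
  refine ⟨U * diagonal (fun i => (d i)⁻¹) * star U, ?_, ?_, ?_, ?_⟩
  · rw [hGU, key, key]
    simp only [mul_inv_mul_cancel]
  · rw [hGU, key, key]
    congr 3
    funext i
    by_cases h : d i = 0 <;> simp [h]
  · rw [← star_eq_conjTranspose, star_mul, star_mul, star_star, star_eq_conjTranspose (diagonal _),
      diagonal_conjTranspose, Matrix.mul_assoc]
    congr 3
    funext i
    simp [d]
  · rw [hGU, key, key]
    congr 3
    funext i
    ring

theorem exists_isMoorePenrose (A : Matrix m n ℂ) : ∃ B, IsMoorePenrose A B := by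
  classical
  obtain ⟨X, h1, h2, h3, h4⟩ :=
    exists_hermitian_generalizedInverse (isHermitian_conjTranspose_mul_self A)
  refine ⟨X * Aᴴ, ?_, ?_, ?_, ?_⟩
  · have h : (A * X * (Aᴴ * A) - A)ᴴ * (A * X * (Aᴴ * A) - A) = 0 := by
      have e : (A * X * (Aᴴ * A) - A)ᴴ * (A * X * (Aᴴ * A) - A) =
          ((Aᴴ * A) * X * (Aᴴ * A) - Aᴴ * A) * (X * (Aᴴ * A) - 1) := by
        simp only [conjTranspose_sub, conjTranspose_mul, conjTranspose_conjTranspose, h3,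
          Matrix.mul_sub, Matrix.sub_mul, Matrix.mul_assoc, Matrix.mul_one]
      rw [e, h1, sub_self, Matrix.zero_mul]
    rw [conjTranspose_mul_self_eq_zero, sub_eq_zero] at h
    simpa only [Matrix.mul_assoc] using h
  · calc X * Aᴴ * A * (X * Aᴴ) = (X * (Aᴴ * A) * X) * Aᴴ := by simp only [Matrix.mul_assoc]
      _ = X * Aᴴ := by rw [h2]
  · simp only [IsHermitian, conjTranspose_mul, conjTranspose_conjTranspose, h3, Matrix.mul_assoc]
  · have e : X * Aᴴ * A = X * (Aᴴ * A) := Matrix.mul_assoc _ _ _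
    rw [IsHermitian, e, conjTranspose_mul, h3, (isHermitian_conjTranspose_mul_self A).eq, h4]

/-- The Moore-Penrose inverse of a complex matrix. -/
noncomputable def mpInv (A : Matrix m n ℂ) : Matrix n m ℂ :=
  (exists_isMoorePenrose A).choose

theorem isMoorePenrose_mpInv (A : Matrix m n ℂ) : IsMoorePenrose A (mpInv A) :=
  (exists_isMoorePenrose A).choose_spec

end MoorePenrose

/-!
Sequences. A finite sequence `(s_j)_{j=0}^m` or an infinite sequence `(s_j)_{j=0}^∞` of complex
matrices is represented by a function `s : ℕ → Matrix _ _ ℂ` together with its last index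
`κ : ℕ∞`; every notion below that refers to `(s_j)_{j=0}^κ` involves only the values `s j` with
`j ≤ κ`.
-/

section Transforms

variable {p q : ℕ}

/-- The sequence generated by right-sided `α`-shifting: `-α s_j + s_{j+1}`. -/
noncomputable def rightShift (α : ℂ) (s : ℕ → Matrix (Fin p) (Fin q) ℂ) :
    ℕ → Matrix (Fin p) (Fin q) ℂ :=
  fun j => -(α • s j) + s (j + 1)

/-- The `[+,α]`-transform `-α s_{j-1} + s_j`, where `s_{-1} = 0`. -/
noncomputable def plusTransform (α : ℂ) (s : ℕ → Matrix (Fin p) (Fin q) ℂ) :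
    ℕ → Matrix (Fin p) (Fin q) ℂ
  | 0 => s 0
  | j + 1 => -(α • s j) + s (j + 1)

/-- The reciprocal sequence: `s_0^♯ = s_0^†` and
`s_j^♯ = -s_0^† ∑_{l=0}^{j-1} s_{j-l} s_l^♯` for `j ≥ 1`. -/
noncomputable def reciprocal (s : ℕ → Matrix (Fin p) (Fin q) ℂ) :
    ℕ → Matrix (Fin q) (Fin p) ℂ
  | 0 => mpInv (s 0)
  | j + 1 => -(mpInv (s 0) * ∑ l : Fin (j + 1), s (j + 1 - (l : ℕ)) * reciprocal s (l : ℕ))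
termination_by j => j
decreasing_by exact l.isLt

/-- The shortened negative reciprocal sequence corresponding to the `[+,α]`-transform. -/
noncomputable def shortReciprocal (α : ℂ) (s : ℕ → Matrix (Fin p) (Fin q) ℂ) :
    ℕ → Matrix (Fin q) (Fin p) ℂ :=
  fun j => -reciprocal (plusTransform α s) (j + 1)

/-- The first `α`-Schur-Stieltjes transform `s_j^{[1,α]}`. The terms with index `≤ κ - 1` depend
only on `s_0, …, s_κ`. -/
noncomputable def schurStieltjes (α : ℂ) (s : ℕ → Matrix (Fin p) (Fin q) ℂ) :
    ℕ → Matrix (Fin p) (Fin q) ℂ :=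
  fun j => s 0 * shortReciprocal α s j * s 0

end Transforms

section Classes

open scoped ComplexOrder

variable {q : ℕ}

/-- The block Hankel matrix `H_n = [s_{j+k}]_{j,k=0}^n`. -/
def blockHankel (s : ℕ → Matrix (Fin q) (Fin q) ℂ) (n : ℕ) :
    Matrix (Fin (n + 1) × Fin q) (Fin (n + 1) × Fin q) ℂ :=
  Matrix.of fun a b => s (a.1 + b.1) a.2 b.2

/-- The block column `y_{l,l+n} = col (s_l, …, s_{l+n})`. -/
def blockCol (s : ℕ → Matrix (Fin q) (Fin q) ℂ) (l n : ℕ) :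
    Matrix (Fin (n + 1) × Fin q) (Fin q) ℂ :=
  Matrix.of fun a b => s (l + a.1) a.2 b

/-- The block row `z_{l,l+n} = [s_l, …, s_{l+n}]`. -/
def blockRow (s : ℕ → Matrix (Fin q) (Fin q) ℂ) (l n : ℕ) :
    Matrix (Fin q) (Fin (n + 1) × Fin q) ℂ :=
  Matrix.of fun a b => s (l + b.1) a b.2

/-- `L_0 = s_0` and `L_n = s_{2n} - z_{n,2n-1} H_{n-1}^† y_{n,2n-1}` for `n ≥ 1`. -/
noncomputable def hankelSchur (s : ℕ → Matrix (Fin q) (Fin q) ℂ) :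
    ℕ → Matrix (Fin q) (Fin q) ℂ
  | 0 => s 0
  | n + 1 => s (2 * (n + 1)) -
      blockRow s (n + 1) n * mpInv (blockHankel s n) * blockCol s (n + 1) n

variable (q)

/-- `H^≥_{q,2n}`: the matrix `H_n` is nonnegative Hermitian. -/
def HNonneg (n : ℕ) : Set (ℕ → Matrix (Fin q) (Fin q) ℂ) :=
  {s | (blockHankel s n).PosSemidef}

/-- `H^>_{q,2n}`: the matrix `H_n` is positive Hermitian. -/
def HPos (n : ℕ) : Set (ℕ → Matrix (Fin q) (Fin q) ℂ) :=
  {s | (blockHankel s n).PosDef}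

/-- `H^{≥,cd}_{q,2n}`: the completely degenerate members of `H^≥_{q,2n}`. -/
def HNonnegCD (n : ℕ) : Set (ℕ → Matrix (Fin q) (Fin q) ℂ) :=
  {s | s ∈ HNonneg q n ∧ hankelSchur s n = 0}

/-- `K^≥_{q,m,α}` for finite `m`. For `m = 2n` or `m = 2n + 1` one has `m / 2 = n`; for
`m = 2n` with `n ≥ 1` one has `(m - 1) / 2 = n - 1`, and for `m = 2n + 1` it is `n`. -/
def KNonnegFin (α : ℝ) (m : ℕ) : Set (ℕ → Matrix (Fin q) (Fin q) ℂ) :=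
  {s | s ∈ HNonneg q (m / 2) ∧ (1 ≤ m → rightShift (α : ℂ) s ∈ HNonneg q ((m - 1) / 2))}

/-- `K^≥_{q,κ,α}` for `κ ∈ ℕ₀ ∪ {∞}`. -/
def KNonneg (α : ℝ) (κ : ℕ∞) : Set (ℕ → Matrix (Fin q) (Fin q) ℂ) :=
  ENat.recTopCoe (C := fun _ => Set (ℕ → Matrix (Fin q) (Fin q) ℂ))
    {s | ∀ m : ℕ, s ∈ KNonnegFin q α m} (fun m => KNonnegFin q α m) κ

/-- `K^{≥,e}_{q,κ,α}`: for finite `κ = m`, some choice of a further matrix `s_{m+1}` gives a member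
of `K^≥_{q,m+1,α}`; for `κ = ∞` it is `K^≥_{q,∞,α}`. -/
def KNonnegExt (α : ℝ) (κ : ℕ∞) : Set (ℕ → Matrix (Fin q) (Fin q) ℂ) :=
  ENat.recTopCoe (C := fun _ => Set (ℕ → Matrix (Fin q) (Fin q) ℂ))
    (KNonneg q α ⊤)
    (fun m => {s | ∃ t ∈ KNonnegFin q α (m + 1), ∀ j ≤ m, t j = s j}) κ

/-- `K^>_{q,m,α}` for finite `m`. -/
def KPosFin (α : ℝ) (m : ℕ) : Set (ℕ → Matrix (Fin q) (Fin q) ℂ) :=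
  {s | s ∈ HPos q (m / 2) ∧ (1 ≤ m → rightShift (α : ℂ) s ∈ HPos q ((m - 1) / 2))}

/-- `K^>_{q,κ,α}` for `κ ∈ ℕ₀ ∪ {∞}`. -/
def KPos (α : ℝ) (κ : ℕ∞) : Set (ℕ → Matrix (Fin q) (Fin q) ℂ) :=
  ENat.recTopCoe (C := fun _ => Set (ℕ → Matrix (Fin q) (Fin q) ℂ))
    {s | ∀ m : ℕ, s ∈ KPosFin q α m} (fun m => KPosFin q α m) κ

/-- `K^{≥,cd}_{q,m,α}` for finite `m`. -/
def KNonnegCDFin (α : ℝ) (m : ℕ) : Set (ℕ → Matrix (Fin q) (Fin q) ℂ) :=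
  {s | s ∈ KNonnegFin q α m ∧
    (∀ n : ℕ, m = 2 * n → s ∈ HNonnegCD q n) ∧
    (∀ n : ℕ, m = 2 * n + 1 → rightShift (α : ℂ) s ∈ HNonnegCD q n)}

/-- `K^{≥,cd}_{q,κ,α}` for `κ ∈ ℕ₀ ∪ {∞}`. -/
def KNonnegCD (α : ℝ) (κ : ℕ∞) : Set (ℕ → Matrix (Fin q) (Fin q) ℂ) :=
  ENat.recTopCoe (C := fun _ => Set (ℕ → Matrix (Fin q) (Fin q) ℂ))
    {s | s ∈ KNonneg q α ⊤ ∧ ∃ m : ℕ, s ∈ KNonnegCDFin q α m}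
    (fun m => KNonnegCDFin q α m) κ

/-- `K^{≥,cd_m}_{q,κ,α}`: members of `K^≥_{q,κ,α}` with `(s_j)_{j=0}^m` in `K^{≥,cd}_{q,m,α}`. -/
def KNonnegCDAt (α : ℝ) (κ : ℕ∞) (m : ℕ) : Set (ℕ → Matrix (Fin q) (Fin q) ℂ) :=
  {s | s ∈ KNonneg q α κ ∧ s ∈ KNonnegCDFin q α m}

end Classes

end StieltjesSeq

/-
Write `s(X) = ∑ s_j X^j`. Suppose first that the `s_j` are Hermitian and that their ranges lie in
the range of `s_0`. Then some power series `F` with constant coefficient `1` satisfies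
`F * (1 - αX) * s(X) = s_0`, and the transform reads off its coefficients:
`s_j^{[1,α]} = -F_{j+1} s_0`. Multiplying a block Hankel matrix from the left by the block lower
triangular Toeplitz matrix `L` of `F` and from the right by `Lᴴ` turns `H_n^{(α)}` of `(s_j)` into
`H_n` of the transform; with `F * (1 - αX)` in place of `F` it turns `H_{n+1}` of `(s_j)` into the
block diagonal matrix of `s_0` and `H_n^{(α)}` of the transform. The matrices `L` are block
unipotent, so these congruences preserve (semi)definiteness and the last Schur complements.

In general, the transform of a sequence with Hermitian `s_0` does not change when every `s_j` is
compressed to the range of `s_0`, and compression keeps the sequence in each of the classes; for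
the completely degenerate and the positive definite classes it does not even change the sequence.
-/

namespace StieltjesSeq

open Matrix
open scoped ComplexOrder

section RangeProjection

variable {m n : Type*} [Fintype m] [Fintype n]

/-- The orthogonal projection onto the column space of `A`. -/
noncomputable def rangeProj (A : Matrix m n ℂ) : Matrix m m ℂ :=
  A * mpInv A

theorem isHermitian_rangeProj (A : Matrix m n ℂ) : (rangeProj A).IsHermitian :=
  (isMoorePenrose_mpInv A).isHermitian_left

theorem rangeProj_mul_self (A : Matrix m n ℂ) : rangeProj A * A = A :=
  (isMoorePenrose_mpInv A).mul_mul_self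

theorem rangeProj_mul_rangeProj (A : Matrix m n ℂ) :
    rangeProj A * rangeProj A = rangeProj A := by
  conv_lhs => rw [rangeProj, ← Matrix.mul_assoc, ← rangeProj, rangeProj_mul_self, ← rangeProj]

theorem mpInv_mul_rangeProj (A : Matrix m n ℂ) : mpInv A * rangeProj A = mpInv A := by
  rw [rangeProj, ← Matrix.mul_assoc, (isMoorePenrose_mpInv A).self_mul_mul]

theorem rangeProj_eq_one [DecidableEq n] {A : Matrix n n ℂ} (hA : IsUnit A) :
    rangeProj A = 1 :=
  hA.mul_right_cancel <| by rw [rangeProj_mul_self, Matrix.one_mul]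

variable {A : Matrix n n ℂ} (hA : A.IsHermitian)
include hA

theorem mpInv_mul_self : mpInv A * A = rangeProj A := by
  classical
  obtain ⟨X, hAXA, hXAX, hX, hAX⟩ := exists_hermitian_generalizedInverse hA
  have hAXh : (A * X).IsHermitian := by
    rw [Matrix.IsHermitian, conjTranspose_mul, hX, hA, hAX]
  have hX_eq : X = mpInv A :=
    IsMoorePenrose.unique ⟨hAXA, hXAX, hAXh, hAX ▸ hAXh⟩ (isMoorePenrose_mpInv A)
  rw [rangeProj, ← hX_eq, hAX]

theorem mul_rangeProj_self : A * rangeProj A = A := by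
  rw [← mpInv_mul_self hA, ← Matrix.mul_assoc, (isMoorePenrose_mpInv A).mul_mul_self]

theorem rangeProj_mul_mpInv : rangeProj A * mpInv A = mpInv A := by
  rw [← mpInv_mul_self hA, (isMoorePenrose_mpInv A).self_mul_mul]

end RangeProjection

section PosSemidef

variable {m n k : Type*} [Fintype m]

theorem mul_eq_zero_of_conjTranspose_mul_mul_eq_zero {M : Matrix m m ℂ} (hM : M.PosSemidef)
    {Y : Matrix m k ℂ} (hY : Yᴴ * (M * Y) = 0) : M * Y = 0 := by
  have hcol (i : k) : M *ᵥ Y.col i = 0 := by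
    rw [← hM.dotProduct_mulVec_zero_iff]
    exact congrFun₂ hY i i
  ext i j
  exact congrFun (hcol j) i

variable [Finite n]
  {A : Matrix m m ℂ} {B : Matrix m n ℂ} {C : Matrix n m ℂ} {D : Matrix n n ℂ}

theorem lowerLeft_mul_eq_zero (h : (fromBlocks A B C D).PosSemidef) {E : Matrix m k ℂ}
    (hE : A * E = 0) : C * E = 0 := by
  have := Fintype.ofFinite n
  have hY : fromBlocks A B C D * fromRows E (0 : Matrix n k ℂ) = 0 := by
    refine mul_eq_zero_of_conjTranspose_mul_mul_eq_zero h ?_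
    simp only [conjTranspose_fromRows_eq_fromCols_conjTranspose, fromBlocks_mul_fromRows,
      fromCols_mul_fromRows, hE, Matrix.mul_zero, conjTranspose_zero, Matrix.zero_mul, add_zero]
  rw [fromBlocks_mul_fromRows, ← fromRows_zero, fromRows_ext_iff] at hY
  simpa only [Matrix.mul_zero, add_zero] using hY.2

theorem rangeProj_mul_upperRight (h : (fromBlocks A B C D).PosSemidef) :
    rangeProj A * B = B := by
  classical
  obtain ⟨hA, hBC, -, -⟩ := isHermitian_fromBlocks_iff.mp h.isHermitian
  have hC : C * (1 - rangeProj A) = 0 := lowerLeft_mul_eq_zero h <| by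
    rw [Matrix.mul_sub, Matrix.mul_one, mul_rangeProj_self hA, sub_self]
  have hC' : C * rangeProj A = C := by
    rw [Matrix.mul_sub, Matrix.mul_one, sub_eq_zero] at hC
    exact hC.symm
  have := congrArg conjTranspose hC'
  rwa [conjTranspose_mul, isHermitian_rangeProj, ← hBC, conjTranspose_conjTranspose] at this

end PosSemidef

section SchurComplement

variable {l m n k R : Type*} [Fintype l] [Fintype m] [Fintype n] [Fintype k] [DecidableEq k]
  [Ring R] [StarRing R]

/-- `S` is a (generalized) Schur complement in `M` of the part complementary to the coordinates
selected by the columns of `E`. For `M = fromBlocks A B C D` and `E = fromRows 0 1` it says that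
`S = D + C * Y` for a solution `Y` of `A * Y + B = 0`, so no pseudoinverse is involved. -/
def IsSchurComplement (M : Matrix m m R) (E : Matrix m k R) (S : Matrix k k R) : Prop :=
  ∃ X : Matrix m k R, Eᴴ * X = 1 ∧ M * X = E * S

theorem IsSchurComplement.eq {M : Matrix m m R} {E : Matrix m k R} {S T : Matrix k k R}
    (hM : M.IsHermitian) (hS : IsSchurComplement M E S) (hT : IsSchurComplement M E T) :
    S = T := by
  have form_eq {X Y : Matrix m k R} {S : Matrix k k R} (hEY : Eᴴ * Y = 1)
      (hMX : M * X = E * S) : Yᴴ * (M * X) = S := by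
    have hYE : Yᴴ * E = 1 := by
      rw [← conjTranspose_conjTranspose E, ← conjTranspose_mul, hEY, conjTranspose_one]
    rw [hMX, ← Matrix.mul_assoc, hYE, Matrix.one_mul]
  obtain ⟨X, hEX, hMX⟩ := hS
  obtain ⟨Y, hEY, hMY⟩ := hT
  have hSh : Sᴴ = S := by
    nth_rw 1 [← form_eq hEX hMX]
    rw [conjTranspose_mul, conjTranspose_mul, conjTranspose_conjTranspose, hM,
      Matrix.mul_assoc, form_eq hEX hMX]
  calc S = (Yᴴ * (M * X))ᴴ := by rw [form_eq hEY hMX, hSh]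
    _ = Xᴴ * (M * Y) := by
      rw [conjTranspose_mul, conjTranspose_mul, conjTranspose_conjTranspose, hM,
        Matrix.mul_assoc]
    _ = T := form_eq hEX hMY

theorem IsSchurComplement.congruence [DecidableEq m] {M L : Matrix m m R} {E : Matrix m k R}
    {S : Matrix k k R} (h : IsSchurComplement M E S) (hL : IsUnit L) (hLE : L * E = E) :
    IsSchurComplement (L * M * Lᴴ) E S := by
  obtain ⟨X, hEX, hMX⟩ := h
  obtain ⟨K, -, hKL⟩ := isUnit_iff_exists.mp hL
  have hKE : K * E = E := by
    rw [← hLE, ← Matrix.mul_assoc, hKL, Matrix.one_mul, hLE]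
  refine ⟨Kᴴ * X, ?_, ?_⟩
  · rw [← Matrix.mul_assoc, ← conjTranspose_mul, hKE, hEX]
  · rw [Matrix.mul_assoc, ← Matrix.mul_assoc Lᴴ, ← conjTranspose_mul, hKL, conjTranspose_one,
      Matrix.one_mul, Matrix.mul_assoc, hMX, ← Matrix.mul_assoc, hLE]

theorem IsSchurComplement.submatrix_equiv {M : Matrix m m R} {E : Matrix m k R}
    {S : Matrix k k R} (h : IsSchurComplement M E S) (e : l ≃ m) :
    IsSchurComplement (M.submatrix e e) (E.submatrix e id) S := by
  obtain ⟨X, hEX, hMX⟩ := h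
  refine ⟨X.submatrix e id, ?_, ?_⟩
  · rw [conjTranspose_submatrix, submatrix_mul_equiv, hEX, submatrix_id_id]
  · rw [submatrix_mul_equiv, hMX]
    rfl

theorem IsSchurComplement.of_fromBlocks_diagonal {A : Matrix m m R} {D : Matrix n n R}
    {E : Matrix n k R} {S : Matrix k k R}
    (h : IsSchurComplement (fromBlocks A 0 0 D) (fromRows 0 E) S) : IsSchurComplement D E S := by
  obtain ⟨X, hEX, hDX⟩ := h
  rw [← fromRows_toRows X] at hEX hDX
  rw [conjTranspose_fromRows_eq_fromCols_conjTranspose, fromCols_mul_fromRows,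
    conjTranspose_zero, Matrix.zero_mul, zero_add] at hEX
  rw [fromBlocks_mul_fromRows, fromRows_mul, fromRows_ext_iff] at hDX
  exact ⟨X.toRows₂, hEX, by simpa only [Matrix.zero_mul, zero_add] using hDX.2⟩

end SchurComplement

section

variable {m k : Type*} [Fintype m] [Fintype k] [DecidableEq k]

theorem isSchurComplement_fromBlocks {A : Matrix m m ℂ} {B : Matrix m k ℂ} {C : Matrix k m ℂ}
    {D : Matrix k k ℂ} (h : (fromBlocks A B C D).PosSemidef) :
    IsSchurComplement (fromBlocks A B C D) (fromRows 0 1) (D - C * mpInv A * B) := by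
  refine ⟨fromRows (-(mpInv A * B)) 1, ?_, ?_⟩
  · simp only [conjTranspose_fromRows_eq_fromCols_conjTranspose, fromCols_mul_fromRows,
      conjTranspose_zero, conjTranspose_one, Matrix.zero_mul, Matrix.one_mul, zero_add]
  · have hB : A * (mpInv A * B) = B := by
      rw [← Matrix.mul_assoc, ← rangeProj, rangeProj_mul_upperRight h]
    simp only [fromBlocks_mul_fromRows, fromRows_mul, Matrix.mul_neg, hB, Matrix.mul_one,
      neg_add_cancel, Matrix.zero_mul, Matrix.one_mul, Matrix.mul_assoc, sub_eq_neg_add]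

end

section HankelToeplitz

open PowerSeries

variable {R : Type*} [Ring R]

/-- The Hankel matrix `[s_{j+k}]_{j,k=0}^n` over a ring. -/
def hankel (s : ℕ → R) (n : ℕ) : Matrix (Fin (n + 1)) (Fin (n + 1)) R :=
  Matrix.of fun j k => s (j + k)

theorem sum_coeff_mul_X_pow_mul_coeff (F H : R⟦X⟧) {j n : ℕ} (hj : j ≤ n) :
    ∑ i : Fin (n + 1), coeff j (F * X ^ (i : ℕ)) * coeff i H = coeff j (F * H) := by
  rw [Fin.sum_univ_eq_sum_range (fun i => coeff j (F * X ^ i) * coeff i H), coeff_mul,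
    ← Finset.Nat.sum_antidiagonal_swap, Finset.Nat.sum_antidiagonal_eq_sum_range_succ_mk]
  simp only [coeff_mul_X_pow', ite_mul, zero_mul, ← Finset.sum_filter, Prod.swap_prod_mk]
  refine Finset.sum_congr ?_ fun _ _ => rfl
  ext i
  simp only [Finset.mem_filter, Finset.mem_range]
  omega

theorem sum_coeff_mul_coeff_mul_X_pow (H G : R⟦X⟧) {k n : ℕ} (hk : k ≤ n) :
    ∑ i : Fin (n + 1), coeff i H * coeff k (G * X ^ (i : ℕ)) = coeff k (H * G) := by
  rw [Fin.sum_univ_eq_sum_range (fun i => coeff i H * coeff k (G * X ^ i)), coeff_mul,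
    Finset.Nat.sum_antidiagonal_eq_sum_range_succ_mk]
  simp only [coeff_mul_X_pow', mul_ite, mul_zero, ← Finset.sum_filter]
  refine Finset.sum_congr ?_ fun _ _ => rfl
  ext i
  simp only [Finset.mem_filter, Finset.mem_range]
  omega

/-- The truncation of a power series to a lower triangular Toeplitz matrix: the `(j, k)` entry
is the coefficient of index `j - k`, and it is zero for `j < k`. -/
noncomputable def lowerToeplitz (n : ℕ) : R⟦X⟧ →+* Matrix (Fin (n + 1)) (Fin (n + 1)) R where
  toFun F := Matrix.of fun j k => coeff j (F * X ^ (k : ℕ))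
  map_one' := by
    ext j k
    simp only [Matrix.of_apply, one_mul, coeff_X_pow, Matrix.one_apply, Fin.ext_iff]
  map_mul' F G := by
    ext j k
    simp only [Matrix.mul_apply, Matrix.of_apply, mul_assoc,
      sum_coeff_mul_X_pow_mul_coeff F _ (Nat.le_of_lt_succ j.isLt)]
  map_zero' := by
    ext j k
    simp only [Matrix.of_apply, zero_mul, map_zero, Matrix.zero_apply]
  map_add' F G := by
    ext j k
    simp only [Matrix.of_apply, add_mul, map_add, Matrix.add_apply]

theorem lowerToeplitz_apply (n : ℕ) (F : R⟦X⟧) (j k : Fin (n + 1)) :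
    lowerToeplitz n F j k = coeff j (F * X ^ (k : ℕ)) := rfl

theorem isUnit_lowerToeplitz (n : ℕ) {F : R⟦X⟧} (hF : constantCoeff F = 1) :
    IsUnit (lowerToeplitz n F) :=
  (isUnit_iff_constantCoeff.mpr (hF ▸ isUnit_one)).map (lowerToeplitz n)

/-- The series with coefficients `∑ s_{a+b} g_{k-b}` (sum over `b ≤ k`) for `a = 0, 1, …`: column
`k` of the infinite Hankel matrix of `s` times the upper triangular Toeplitz matrix of `G`. -/
noncomputable def hankelColumn (s : ℕ → R) (G : R⟦X⟧) (k : ℕ) : R⟦X⟧ :=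
  mk fun a => coeff k (mk (fun b => s (a + b)) * G)

/-- The `(j, k)` entry `∑ f_{j-a} s_{a+b} g_{k-b}` of the Hankel matrix of `s` multiplied by the
lower triangular Toeplitz matrix of `F` and the upper triangular one of `G`. -/
noncomputable def hankelConv (F : R⟦X⟧) (s : ℕ → R) (G : R⟦X⟧) (j k : ℕ) : R :=
  coeff j (F * hankelColumn s G k)

variable (F G : R⟦X⟧) (s : ℕ → R)

theorem hankelConv_zero_left (k : ℕ) :
    hankelConv F s G 0 k = constantCoeff F * coeff k (mk s * G) := by
  rw [hankelConv, coeff_zero_eq_constantCoeff_apply, map_mul, hankelColumn, constantCoeff_mk]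
  simp only [zero_add]

theorem hankelColumn_zero : hankelColumn s G 0 = mk s * C (constantCoeff G) := by
  ext a
  rw [hankelColumn, coeff_mk, coeff_zero_eq_constantCoeff_apply, map_mul, constantCoeff_mk,
    coeff_mul_C, coeff_mk, add_zero]

theorem hankelColumn_succ (k : ℕ) : hankelColumn s G (k + 1) =
    mk s * C (coeff (k + 1) G) + hankelColumn (fun j => s (j + 1)) G k := by
  ext a
  simp only [hankelColumn, map_add, coeff_mk, coeff_mul_C]
  rw [eq_X_mul_shift_add_const (mk fun b => s (a + b)), add_mul, mul_assoc, map_add,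
    coeff_succ_X_mul, coeff_C_mul, add_comm]
  simp only [constantCoeff_mk, coeff_mk, add_zero, add_assoc]

theorem hankelConv_zero_right (j : ℕ) :
    hankelConv F s G j 0 = coeff j (F * mk s) * constantCoeff G := by
  rw [hankelConv, hankelColumn_zero, ← mul_assoc, coeff_mul_C]

theorem hankelConv_succ_right (j k : ℕ) : hankelConv F s G j (k + 1) =
    coeff j (F * mk s) * coeff (k + 1) G + hankelConv F (fun i => s (i + 1)) G j k := by
  rw [hankelConv, hankelColumn_succ, mul_add, map_add, ← mul_assoc, coeff_mul_C, hankelConv]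

theorem hankelConv_succ_left (j k : ℕ) : hankelConv F s G (j + 1) k =
    coeff (j + 1) F * coeff k (mk s * G) + hankelConv F (fun i => s (i + 1)) G j k := by
  rw [hankelConv, eq_shift_mul_X_add_const (hankelColumn s G k), mul_add, map_add, ← mul_assoc,
    coeff_succ_mul_X, coeff_mul_C, hankelConv, add_comm]
  simp only [hankelColumn, constantCoeff_mk, coeff_mk, zero_add, Nat.add_right_comm _ 1]

theorem lowerToeplitz_mul_hankel_mul_conjTranspose [StarRing R] (n : ℕ) (j k : Fin (n + 1)) :
    (lowerToeplitz n F * hankel s n * (lowerToeplitz n F)ᴴ) j k =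
      hankelConv F s (mk fun i => star (coeff i F)) j k := by
  set G : R⟦X⟧ := mk fun i => star (coeff i F) with hG
  have star_apply (b : Fin (n + 1)) :
      star (lowerToeplitz n F k b) = coeff k (G * X ^ (b : ℕ)) := by
    simp only [lowerToeplitz_apply, coeff_mul_X_pow', apply_ite star, star_zero, hG, coeff_mk]
  have hankel_mul (a : Fin (n + 1)) :
      (hankel s n * (lowerToeplitz n F)ᴴ) a k = coeff a (hankelColumn s G k) := by
    rw [hankelColumn, coeff_mk,
      ← sum_coeff_mul_coeff_mul_X_pow (mk fun b => s (a + b)) G (Nat.le_of_lt_succ k.isLt)]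
    simp only [Matrix.mul_apply, conjTranspose_apply, star_apply, hankel, Matrix.of_apply,
      coeff_mk]
  rw [Matrix.mul_assoc, Matrix.mul_apply, hankelConv,
    ← sum_coeff_mul_X_pow_mul_coeff F _ (Nat.le_of_lt_succ j.isLt)]
  simp only [hankel_mul, lowerToeplitz_apply]

variable {F G s} {a : R} (hF : F * mk s = C a) (hG : mk s * G = C a)
include hF hG

theorem hankelConv_shift (j k : ℕ) :
    hankelConv F (fun i => s (i + 1)) G j k = -(coeff (j + k + 1) F * a) := by
  induction k generalizing j with
  | zero =>
    have h := hankelConv_succ_left F G s j 0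
    rw [hankelConv_zero_right, hF, hG, coeff_zero_C, coeff_succ_C, zero_mul] at h
    exact (neg_eq_of_add_eq_zero_right h.symm).symm
  | succ k ih =>
    calc hankelConv F (fun i => s (i + 1)) G j (k + 1)
        = hankelConv F s G (j + 1) (k + 1) := by
          rw [hankelConv_succ_left, hG, coeff_succ_C, mul_zero, zero_add]
      _ = hankelConv F (fun i => s (i + 1)) G (j + 1) k := by
          rw [hankelConv_succ_right, hF, coeff_succ_C, zero_mul, zero_add]
      _ = -(coeff (j + (k + 1) + 1) F * a) := by
          rw [ih, Nat.add_right_comm j 1 k]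
          rfl

theorem hankelConv_succ_succ (j k : ℕ) :
    hankelConv F s G (j + 1) (k + 1) = -(coeff (j + k + 2) F * a) := by
  rw [hankelConv_succ_left, hG, coeff_succ_C, mul_zero, zero_add, hankelConv_shift hF hG]
  rfl

omit hF hG in
theorem mk_mul_mk_star_coeff [StarRing R] (hs : ∀ j, IsSelfAdjoint (s j)) (ha : IsSelfAdjoint a)
    (hF : F * mk s = C a) : mk s * mk (fun i => star (coeff i F)) = C a := by
  ext k
  have hk : star (coeff k (F * mk s)) = coeff k (C a) := by
    rw [hF, coeff_C, apply_ite star, star_zero, ha.star_eq]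
  rw [← hk, coeff_mul, coeff_mul, star_sum, ← Finset.Nat.sum_antidiagonal_swap]
  simp only [coeff_mk, star_mul, (hs _).star_eq, Prod.fst_swap, Prod.snd_swap]

end HankelToeplitz

section BlockHankel

variable {q : ℕ} {s : ℕ → Matrix (Fin q) (Fin q) ℂ}

/-- The column of blocks `0, …, 0, I`. -/
def lastBlock (q n : ℕ) : Matrix (Fin (n + 1) × Fin q) (Fin q) ℂ :=
  (1 : Matrix (Fin (n + 1) × Fin q) (Fin (n + 1) × Fin q) ℂ).submatrix id (Prod.mk (Fin.last n))

/-- Splitting off the first block of indices. -/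
def headBlockEquiv (q n : ℕ) : Fin q ⊕ Fin (n + 1) × Fin q ≃ Fin (n + 2) × Fin q :=
  optionProdEquiv.symm.trans
    ((finSuccEquiv (n + 1)).symm.prodCongr (Equiv.refl (Fin q)))

/-- Splitting off the last block of indices. -/
def lastBlockEquiv (q n : ℕ) : (Fin (n + 1) × Fin q) ⊕ Fin q ≃ Fin (n + 2) × Fin q :=
  (Equiv.sumComm _ _).trans <| optionProdEquiv.symm.trans
    (finSuccEquivLast.symm.prodCongr (Equiv.refl (Fin q)))

theorem lastBlock_submatrix_headBlockEquiv (n : ℕ) :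
    (lastBlock q (n + 1)).submatrix (headBlockEquiv q n) id = fromRows 0 (lastBlock q n) := by
  ext (a | ⟨i, a⟩) b
  · simp [lastBlock, headBlockEquiv]
  · simp [lastBlock, headBlockEquiv, Matrix.one_apply, ← Fin.succ_last]

theorem lastBlock_submatrix_lastBlockEquiv (n : ℕ) :
    (lastBlock q (n + 1)).submatrix (lastBlockEquiv q n) id = fromRows 0 1 := by
  ext (⟨i, a⟩ | a) b
  · simp [lastBlock, lastBlockEquiv]
  · simp [lastBlock, lastBlockEquiv, Matrix.one_apply]

theorem blockHankel_submatrix_lastBlockEquiv (s : ℕ → Matrix (Fin q) (Fin q) ℂ) (n : ℕ) :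
    (blockHankel s (n + 1)).submatrix (lastBlockEquiv q n) (lastBlockEquiv q n) =
      fromBlocks (blockHankel s n) (blockCol s (n + 1) n) (blockRow s (n + 1) n)
        (s (2 * (n + 1))) := by
  ext (⟨i, a⟩ | a) (⟨j, b⟩ | b) <;>
    simp [blockHankel, blockCol, blockRow, lastBlockEquiv, add_comm, two_mul]

theorem isSchurComplement_hankelSchur {n : ℕ} (h : (blockHankel s n).PosSemidef) :
    IsSchurComplement (blockHankel s n) (lastBlock q n) (hankelSchur s n) := by
  cases n with
  | zero =>
    refine ⟨lastBlock q 0, ?_, ?_⟩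
    · ext a b
      simp [lastBlock, Matrix.mul_apply, Matrix.one_apply]
    · ext ⟨i, a⟩ b
      simp [lastBlock, blockHankel, hankelSchur, Matrix.mul_apply, Matrix.one_apply,
        Fin.fin_one_eq_zero i]
  | succ n =>
    have hblocks := h.submatrix (lastBlockEquiv q n)
    rw [blockHankel_submatrix_lastBlockEquiv] at hblocks
    have hS := (isSchurComplement_fromBlocks hblocks).submatrix_equiv (lastBlockEquiv q n).symm
    rw [← blockHankel_submatrix_lastBlockEquiv, ← lastBlock_submatrix_lastBlockEquiv] at hS
    simpa [submatrix_submatrix, hankelSchur] using hS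

theorem mul_eq_zero_of_blockHankel {n j k : ℕ} (h : (blockHankel s n).PosSemidef) (hk : k ≤ n)
    (hj : j ≤ n) {E : Matrix (Fin q) (Fin q) ℂ} (hE : s (2 * k) * E = 0) : s (k + j) * E = 0 := by
  have hblocks := h.submatrix (Sum.elim (Prod.mk ⟨k, Nat.lt_succ_of_le hk⟩)
    (Prod.mk ⟨j, Nat.lt_succ_of_le hj⟩))
  have heq : (blockHankel s n).submatrix (Sum.elim (Prod.mk ⟨k, Nat.lt_succ_of_le hk⟩)
      (Prod.mk ⟨j, Nat.lt_succ_of_le hj⟩)) (Sum.elim (Prod.mk ⟨k, Nat.lt_succ_of_le hk⟩)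
      (Prod.mk ⟨j, Nat.lt_succ_of_le hj⟩)) =
      fromBlocks (s (2 * k)) (s (k + j)) (s (k + j)) (s (2 * j)) := by
    ext (a | a) (b | b) <;> simp [blockHankel, two_mul, add_comm]
  rw [heq] at hblocks
  exact lowerLeft_mul_eq_zero hblocks hE

theorem mul_eq_zero_of_zero_mul_eq_zero {n : ℕ} (h : (blockHankel s n).PosSemidef)
    {E : Matrix (Fin q) (Fin q) ℂ} (hE : s 0 * E = 0) (j : ℕ) (hj : j < 2 * n) :
    s j * E = 0 := by
  induction j using Nat.strong_induction_on with
  | _ j ih =>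
    rcases le_or_gt j n with hjn | hjn
    · rw [← zero_add j]
      exact mul_eq_zero_of_blockHankel h (Nat.zero_le n) hjn hE
    · obtain ⟨k, rfl⟩ := Nat.exists_eq_add_of_le' hjn.le
      exact mul_eq_zero_of_blockHankel h (by omega) le_rfl (ih _ (by omega) (by omega))

theorem mul_eq_zero_of_hankelSchur_eq_zero {n : ℕ} (h : hankelSchur s n = 0)
    {E : Matrix (Fin q) (Fin q) ℂ} (hE : ∀ j < 2 * n, s j * E = 0) : s (2 * n) * E = 0 := by
  cases n with
  | zero =>
    rw [hankelSchur] at h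
    rw [h, Matrix.zero_mul]
  | succ n =>
    have hcol : blockCol s (n + 1) n * E = 0 := by
      ext i b
      exact congrFun₂ (hE (n + 1 + i.1) (by omega)) i.2 b
    rw [hankelSchur, sub_eq_zero] at h
    rw [h, Matrix.mul_assoc, hcol, Matrix.mul_zero]

open PowerSeries

/-- The block lower triangular Toeplitz matrix of a matrix power series. -/
noncomputable def blockToeplitz (n : ℕ) (F : (Matrix (Fin q) (Fin q) ℂ)⟦X⟧) :
    Matrix (Fin (n + 1) × Fin q) (Fin (n + 1) × Fin q) ℂ :=
  compRingEquiv _ _ _ (lowerToeplitz n F)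

variable {F : (Matrix (Fin q) (Fin q) ℂ)⟦X⟧}

theorem isUnit_blockToeplitz (n : ℕ) (hF : constantCoeff F = 1) : IsUnit (blockToeplitz n F) :=
  (isUnit_lowerToeplitz n hF).map (compRingEquiv (Fin (n + 1)) (Fin q) ℂ)

theorem blockToeplitz_mul_lastBlock (n : ℕ) (hF : constantCoeff F = 1) :
    blockToeplitz n F * lastBlock q n = lastBlock q n := by
  have hlast (i : Fin (n + 1)) :
      lowerToeplitz n F i (Fin.last n) =
        (1 : Matrix _ _ (Matrix (Fin q) (Fin q) ℂ)) i (Fin.last n) := by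
    have hi : n ≤ (i : ℕ) ↔ i = Fin.last n := Fin.last_le_iff
    rw [lowerToeplitz_apply, Fin.val_last, coeff_mul_X_pow', Matrix.one_apply]
    refine if_ctx_congr hi (fun h => ?_) fun _ => rfl
    rw [h, Fin.val_last, Nat.sub_self, coeff_zero_eq_constantCoeff_apply, hF]
  have hmul : blockToeplitz n F * lastBlock q n =
      (blockToeplitz n F).submatrix id (Prod.mk (Fin.last n)) :=
    mul_submatrix_one (Equiv.refl _) _ _
  rw [hmul, lastBlock, ← map_one (compRingEquiv (Fin (n + 1)) (Fin q) ℂ)]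
  ext ⟨i, a⟩ b
  exact congrFun₂ (hlast i) a b

theorem blockToeplitz_mul_blockHankel_mul_conjTranspose (s : ℕ → Matrix (Fin q) (Fin q) ℂ)
    (n : ℕ) :
    blockToeplitz n F * blockHankel s n * (blockToeplitz n F)ᴴ =
      compRingEquiv _ _ _ (Matrix.of fun j k : Fin (n + 1) =>
        hankelConv F s (mk fun i => star (coeff i F)) j k) := by
  have hconj : (blockToeplitz n F)ᴴ = compRingEquiv _ _ _ (lowerToeplitz n F)ᴴ := rfl
  have hhankel : blockHankel s n = compRingEquiv _ _ _ (hankel s n) := rfl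
  rw [hconj, hhankel, blockToeplitz, ← map_mul, ← map_mul]
  exact congrArg _ (Matrix.ext (lowerToeplitz_mul_hankel_mul_conjTranspose F s n))

variable {a : Matrix (Fin q) (Fin q) ℂ} (hs : ∀ j, (s j).IsHermitian) (ha : a.IsHermitian)
  (hF : F * mk s = C a)
include hs ha hF

theorem blockToeplitz_mul_blockHankel_shift (n : ℕ) :
    blockToeplitz n F * blockHankel (fun j => s (j + 1)) n * (blockToeplitz n F)ᴴ =
      blockHankel (fun j => -(coeff (j + 1) F * a)) n := by
  rw [blockToeplitz_mul_blockHankel_mul_conjTranspose]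
  ext ⟨j, b⟩ ⟨k, c⟩
  exact congrFun₂ (hankelConv_shift hF (mk_mul_mk_star_coeff hs ha hF) j k) b c

theorem blockToeplitz_mul_blockHankel_submatrix (hF₀ : constantCoeff F = 1) (n : ℕ) :
    (blockToeplitz (n + 1) F * blockHankel s (n + 1) * (blockToeplitz (n + 1) F)ᴴ).submatrix
        (headBlockEquiv q n) (headBlockEquiv q n) =
      fromBlocks a 0 0 (blockHankel (fun j => -(coeff (j + 2) F * a)) n) := by
  have hG := mk_mul_mk_star_coeff hs ha hF
  rw [blockToeplitz_mul_blockHankel_mul_conjTranspose]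
  ext (b | ⟨j, b⟩) (c | ⟨k, c⟩)
  · refine congrFun₂ (?_ : hankelConv F s _ 0 0 = a) b c
    rw [hankelConv_zero_left, hF₀, one_mul, hG, coeff_zero_C]
  · refine congrFun₂ (?_ : hankelConv F s _ 0 (k + 1) = 0) b c
    rw [hankelConv_zero_left, hG, coeff_succ_C, mul_zero]
  · refine congrFun₂ (?_ : hankelConv F s _ (j + 1) 0 = 0) b c
    rw [hankelConv_zero_right, hF, coeff_succ_C, zero_mul]
  · exact congrFun₂ (hankelConv_succ_succ hF hG j k) b c

end BlockHankel

section Reciprocal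

open PowerSeries

variable {q : ℕ}

/-- The series `1 + ∑ u_j u_0^† X^j` (sum over `j ≥ 1`). -/
noncomputable def monicSeries (u : ℕ → Matrix (Fin q) (Fin q) ℂ) :
    (Matrix (Fin q) (Fin q) ℂ)⟦X⟧ :=
  mk fun j => if j = 0 then 1 else u j * mpInv (u 0)

/-- The multiplicative inverse of `monicSeries u`. -/
noncomputable def monicInverse (u : ℕ → Matrix (Fin q) (Fin q) ℂ) :
    (Matrix (Fin q) (Fin q) ℂ)⟦X⟧ :=
  invOfUnit (monicSeries u) 1

variable (u : ℕ → Matrix (Fin q) (Fin q) ℂ)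

theorem coeff_succ_monicSeries (j : ℕ) :
    coeff (j + 1) (monicSeries u) = u (j + 1) * mpInv (u 0) := by
  rw [monicSeries, coeff_mk, if_neg j.succ_ne_zero]

theorem constantCoeff_monicSeries : constantCoeff (monicSeries u) = 1 := by
  rw [monicSeries, constantCoeff_mk, if_pos rfl]

theorem constantCoeff_monicInverse : constantCoeff (monicInverse u) = 1 := by
  rw [monicInverse, constantCoeff_invOfUnit, inv_one, Units.val_one]

theorem monicSeries_mul_monicInverse : monicSeries u * monicInverse u = 1 :=
  mul_invOfUnit _ _ (constantCoeff_monicSeries u)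

theorem monicInverse_mul_monicSeries : monicInverse u * monicSeries u = 1 :=
  invOfUnit_mul _ _ (constantCoeff_monicSeries u)

theorem reciprocal_zero : reciprocal u 0 = mpInv (u 0) := by rw [reciprocal]

theorem reciprocal_succ (j : ℕ) : reciprocal u (j + 1) =
    -(mpInv (u 0) * ∑ l ∈ Finset.range (j + 1), u (j + 1 - l) * reciprocal u l) := by
  rw [reciprocal, Fin.sum_univ_eq_sum_range fun l => u (j + 1 - l) * reciprocal u l]

theorem coeff_succ_monicInverse (j : ℕ) : coeff (j + 1) (monicInverse u) =
    -∑ l ∈ Finset.range (j + 1), u (j + 1 - l) * (mpInv (u 0) * coeff l (monicInverse u)) := by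
  have h : coeff (j + 1) (monicSeries u * monicInverse u) = 0 := by
    rw [monicSeries_mul_monicInverse, coeff_one, if_neg j.succ_ne_zero]
  rw [coeff_mul, ← Finset.Nat.sum_antidiagonal_swap,
    Finset.Nat.sum_antidiagonal_eq_sum_range_succ_mk, Finset.sum_range_succ] at h
  simp only [Prod.swap_prod_mk, Nat.sub_self, coeff_zero_eq_constantCoeff_apply,
    constantCoeff_monicSeries, one_mul] at h
  rw [eq_neg_of_add_eq_zero_right h]
  refine congrArg _ (Finset.sum_congr rfl fun l hl => ?_)
  rw [Nat.succ_sub (Finset.mem_range_succ_iff.mp hl), coeff_succ_monicSeries, Matrix.mul_assoc]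

theorem reciprocal_eq_mpInv_mul_coeff_monicInverse (j : ℕ) :
    reciprocal u j = mpInv (u 0) * coeff j (monicInverse u) := by
  induction j using Nat.strong_induction_on with
  | _ j ih =>
    cases j with
    | zero =>
      rw [reciprocal_zero, coeff_zero_eq_constantCoeff_apply, constantCoeff_monicInverse, mul_one]
    | succ j =>
      rw [reciprocal_succ, coeff_succ_monicInverse, Matrix.mul_neg]
      refine congrArg (fun x => -(mpInv (u 0) * x)) (Finset.sum_congr rfl fun l hl => ?_)
      rw [ih l (Finset.mem_range.mp hl)]

/-- A sequence of Hermitian matrices whose ranges are contained in the range of the first one. -/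
structure IsFirstTermDominant (s : ℕ → Matrix (Fin q) (Fin q) ℂ) : Prop where
  isHermitian (j : ℕ) : (s j).IsHermitian
  rangeProj_mul (j : ℕ) : rangeProj (s 0) * s j = s j

namespace IsFirstTermDominant

variable {u} (hu : IsFirstTermDominant u)
include hu

theorem mul_rangeProj (j : ℕ) : u j * rangeProj (u 0) = u j := by
  have h := congrArg conjTranspose (hu.rangeProj_mul j)
  rwa [conjTranspose_mul, isHermitian_rangeProj, hu.isHermitian] at h

theorem monicSeries_mul_C : monicSeries u * C (u 0) = PowerSeries.mk u := by
  ext1 j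
  rw [coeff_mul_C, coeff_mk]
  cases j with
  | zero => rw [coeff_zero_eq_constantCoeff_apply, constantCoeff_monicSeries, one_mul]
  | succ j =>
    rw [coeff_succ_monicSeries, Matrix.mul_assoc, mpInv_mul_self (hu.isHermitian 0),
      hu.mul_rangeProj]

theorem monicInverse_mul_mk : monicInverse u * PowerSeries.mk u = C (u 0) := by
  rw [← hu.monicSeries_mul_C, ← mul_assoc, monicInverse_mul_monicSeries, one_mul]

theorem rangeProj_mul_coeff_succ_monicInverse (j : ℕ) :
    rangeProj (u 0) * coeff (j + 1) (monicInverse u) = coeff (j + 1) (monicInverse u) := by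
  rw [coeff_succ_monicInverse, Matrix.mul_neg, Finset.mul_sum]
  simp only [← Matrix.mul_assoc, hu.rangeProj_mul]

end IsFirstTermDominant

variable {s : ℕ → Matrix (Fin q) (Fin q) ℂ}

theorem mk_plusTransform (α : ℂ) (s : ℕ → Matrix (Fin q) (Fin q) ℂ) :
    mk (plusTransform α s) = (1 - α • X) * mk s := by
  ext1 j
  rw [sub_mul, one_mul, smul_mul_assoc, map_sub, coeff_smul]
  cases j with
  | zero => rw [coeff_zero_X_mul, smul_zero, sub_zero, coeff_mk, coeff_mk, plusTransform]
  | succ j => rw [coeff_succ_X_mul, coeff_mk, coeff_mk, coeff_mk, plusTransform, neg_add_eq_sub]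

variable (hs : IsFirstTermDominant s) (α : ℝ)
include hs

theorem isFirstTermDominant_plusTransform : IsFirstTermDominant (plusTransform (α : ℂ) s) where
  isHermitian
    | 0 => hs.isHermitian 0
    | j + 1 => by
      have hα : IsSelfAdjoint (α : ℂ) := Complex.conj_ofReal α
      exact (hα.smul (hs.isHermitian j).isSelfAdjoint).neg.add (hs.isHermitian (j + 1))
  rangeProj_mul
    | 0 => hs.rangeProj_mul 0
    | j + 1 => by
      have h := hs.rangeProj_mul
      simp only [plusTransform, Matrix.mul_add, Matrix.mul_neg, Matrix.mul_smul, h]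

theorem schurStieltjes_eq_neg_coeff_mul : schurStieltjes (α : ℂ) s =
    fun j => -(coeff (j + 1) (monicInverse (plusTransform (α : ℂ) s)) * s 0) := by
  funext j
  have h := (isFirstTermDominant_plusTransform hs α).rangeProj_mul_coeff_succ_monicInverse j
  rw [schurStieltjes, shortReciprocal, reciprocal_eq_mpInv_mul_coeff_monicInverse, Matrix.mul_neg,
    Matrix.neg_mul, ← Matrix.mul_assoc]
  exact congrArg (fun x => -(x * s 0)) h

theorem monicInverse_plusTransform_mul_mk :
    monicInverse (plusTransform (α : ℂ) s) * (1 - (α : ℂ) • X) * mk s = C (s 0) := by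
  rw [mul_assoc, ← mk_plusTransform]
  exact (isFirstTermDominant_plusTransform hs α).monicInverse_mul_mk

theorem rightShift_schurStieltjes_eq_neg_coeff_mul :
    rightShift (α : ℂ) (schurStieltjes (α : ℂ) s) = fun j =>
      -(coeff (j + 2) (monicInverse (plusTransform (α : ℂ) s) * (1 - (α : ℂ) • X)) * s 0) := by
  funext j
  rw [schurStieltjes_eq_neg_coeff_mul hs, rightShift, mul_sub, mul_one, mul_smul_comm, map_sub,
    coeff_smul, coeff_succ_mul_X, Matrix.sub_mul, Matrix.smul_mul, smul_neg, neg_neg, neg_sub]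
  exact (sub_eq_add_neg _ _).symm

omit hs in
theorem constantCoeff_monicInverse_plusTransform_mul :
    constantCoeff (monicInverse (plusTransform (α : ℂ) s) * (1 - (α : ℂ) • X)) = 1 := by
  rw [map_mul, constantCoeff_monicInverse, one_mul, map_sub, map_one,
    ← coeff_zero_eq_constantCoeff_apply, coeff_smul, coeff_zero_X, smul_zero, sub_zero]

theorem exists_congruence_schurStieltjes (n : ℕ) :
    ∃ L, IsUnit L ∧ L * lastBlock q n = lastBlock q n ∧
      L * blockHankel (rightShift (α : ℂ) s) n * Lᴴ = blockHankel (schurStieltjes (α : ℂ) s) n := by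
  have hu := isFirstTermDominant_plusTransform hs α
  have hF := constantCoeff_monicInverse (plusTransform (α : ℂ) s)
  refine ⟨_, isUnit_blockToeplitz n hF, blockToeplitz_mul_lastBlock n hF, ?_⟩
  rw [schurStieltjes_eq_neg_coeff_mul hs]
  exact blockToeplitz_mul_blockHankel_shift hu.isHermitian (hs.isHermitian 0)
    hu.monicInverse_mul_mk n

theorem exists_congruence_rightShift_schurStieltjes (n : ℕ) :
    ∃ L, IsUnit L ∧ L * lastBlock q (n + 1) = lastBlock q (n + 1) ∧
      (L * blockHankel s (n + 1) * Lᴴ).submatrix (headBlockEquiv q n) (headBlockEquiv q n) =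
        fromBlocks (s 0) 0 0 (blockHankel (rightShift (α : ℂ) (schurStieltjes (α : ℂ) s)) n) := by
  have hF := constantCoeff_monicInverse_plusTransform_mul (s := s) α
  refine ⟨_, isUnit_blockToeplitz (n + 1) hF, blockToeplitz_mul_lastBlock (n + 1) hF, ?_⟩
  rw [rightShift_schurStieltjes_eq_neg_coeff_mul hs]
  exact blockToeplitz_mul_blockHankel_submatrix hs.isHermitian (hs.isHermitian 0)
    (monicInverse_plusTransform_mul_mk hs α) hF n

end Reciprocal

section FirstTermDominant

variable {q m n : ℕ} {s : ℕ → Matrix (Fin q) (Fin q) ℂ} {α : ℝ} (hs : IsFirstTermDominant s)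
include hs

theorem schurStieltjes_mem_HNonneg (h : rightShift (α : ℂ) s ∈ HNonneg q n) :
    schurStieltjes (α : ℂ) s ∈ HNonneg q n := by
  obtain ⟨L, -, -, hL⟩ := exists_congruence_schurStieltjes hs α n
  have hpsd := PosSemidef.mul_mul_conjTranspose_same h L
  rwa [hL] at hpsd

theorem rightShift_schurStieltjes_mem_HNonneg (h : s ∈ HNonneg q (n + 1)) :
    rightShift (α : ℂ) (schurStieltjes (α : ℂ) s) ∈ HNonneg q n := by
  obtain ⟨L, -, -, hL⟩ := exists_congruence_rightShift_schurStieltjes hs α n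
  have hpsd := (PosSemidef.mul_mul_conjTranspose_same h L).submatrix (headBlockEquiv q n)
  rw [hL] at hpsd
  exact hpsd.submatrix Sum.inr

theorem schurStieltjes_mem_HPos (h : rightShift (α : ℂ) s ∈ HPos q n) :
    schurStieltjes (α : ℂ) s ∈ HPos q n := by
  obtain ⟨L, hLu, -, hL⟩ := exists_congruence_schurStieltjes hs α n
  have hpd := hLu.posDef_star_right_conjugate_iff.mpr h
  rwa [star_eq_conjTranspose, hL] at hpd

theorem rightShift_schurStieltjes_mem_HPos (h : s ∈ HPos q (n + 1)) :
    rightShift (α : ℂ) (schurStieltjes (α : ℂ) s) ∈ HPos q n := by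
  obtain ⟨L, hLu, -, hL⟩ := exists_congruence_rightShift_schurStieltjes hs α n
  have hpd := (hLu.posDef_star_right_conjugate_iff.mpr h).submatrix (headBlockEquiv q n).injective
  rw [star_eq_conjTranspose, hL] at hpd
  exact hpd.submatrix Sum.inr_injective

theorem hankelSchur_schurStieltjes (h : rightShift (α : ℂ) s ∈ HNonneg q n) :
    hankelSchur (schurStieltjes (α : ℂ) s) n = hankelSchur (rightShift (α : ℂ) s) n := by
  obtain ⟨L, hLu, hLlast, hL⟩ := exists_congruence_schurStieltjes hs α n
  have hT := schurStieltjes_mem_HNonneg hs h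
  have hschur := (isSchurComplement_hankelSchur h).congruence hLu hLlast
  rw [hL] at hschur
  exact (isSchurComplement_hankelSchur hT).eq hT.isHermitian hschur

theorem hankelSchur_rightShift_schurStieltjes (h : s ∈ HNonneg q (n + 1)) :
    hankelSchur (rightShift (α : ℂ) (schurStieltjes (α : ℂ) s)) n = hankelSchur s (n + 1) := by
  obtain ⟨L, hLu, hLlast, hL⟩ := exists_congruence_rightShift_schurStieltjes hs α n
  have hT := rightShift_schurStieltjes_mem_HNonneg (α := α) hs h
  have hschur := ((isSchurComplement_hankelSchur h).congruence hLu hLlast).submatrix_equiv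
    (headBlockEquiv q n)
  rw [hL, lastBlock_submatrix_headBlockEquiv] at hschur
  exact (isSchurComplement_hankelSchur hT).eq hT.isHermitian hschur.of_fromBlocks_diagonal

theorem IsFirstTermDominant.schurStieltjes_mem_KNonnegFin (h : s ∈ KNonnegFin q α (m + 1)) :
    schurStieltjes (α : ℂ) s ∈ KNonnegFin q α m := by
  refine ⟨schurStieltjes_mem_HNonneg hs (h.2 m.succ_pos), fun hm => ?_⟩
  refine rightShift_schurStieltjes_mem_HNonneg hs ?_
  rw [show (m - 1) / 2 + 1 = (m + 1) / 2 by omega]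
  exact h.1

theorem IsFirstTermDominant.schurStieltjes_mem_KPosFin (h : s ∈ KPosFin q α (m + 1)) :
    schurStieltjes (α : ℂ) s ∈ KPosFin q α m := by
  refine ⟨schurStieltjes_mem_HPos hs (h.2 m.succ_pos), fun hm => ?_⟩
  refine rightShift_schurStieltjes_mem_HPos hs ?_
  rw [show (m - 1) / 2 + 1 = (m + 1) / 2 by omega]
  exact h.1

theorem IsFirstTermDominant.schurStieltjes_mem_KNonnegCDFin (h : s ∈ KNonnegCDFin q α (m + 1)) :
    schurStieltjes (α : ℂ) s ∈ KNonnegCDFin q α m := by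
  refine ⟨hs.schurStieltjes_mem_KNonnegFin h.1, fun n hn => ?_, fun n hn => ?_⟩
  · obtain ⟨hpsd, hzero⟩ := h.2.2 n (congrArg (· + 1) hn)
    exact ⟨schurStieltjes_mem_HNonneg hs hpsd,
      (hankelSchur_schurStieltjes hs hpsd).trans hzero⟩
  · obtain ⟨hpsd, hzero⟩ := h.2.1 (n + 1) (congrArg (· + 1) hn)
    exact ⟨rightShift_schurStieltjes_mem_HNonneg hs hpsd,
      (hankelSchur_rightShift_schurStieltjes hs hpsd).trans hzero⟩

end FirstTermDominant

section Locality

variable {q m n : ℕ} {s s' : ℕ → Matrix (Fin q) (Fin q) ℂ} {α : ℝ}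

theorem rightShift_congr (a : ℂ) (h : ∀ j ≤ m + 1, s j = s' j) (j : ℕ) (hj : j ≤ m) :
    rightShift a s j = rightShift a s' j := by
  rw [rightShift, rightShift, h j (hj.trans m.le_succ), h (j + 1) (Nat.succ_le_succ hj)]

theorem plusTransform_congr (a : ℂ) (h : ∀ j ≤ m, s j = s' j) (j : ℕ) (hj : j ≤ m) :
    plusTransform a s j = plusTransform a s' j := by
  cases j with
  | zero => exact h 0 hj
  | succ j => rw [plusTransform, plusTransform, h j (Nat.le_of_succ_le hj), h (j + 1) hj]

theorem blockHankel_congr (h : ∀ j ≤ 2 * n, s j = s' j) : blockHankel s n = blockHankel s' n := by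
  ext i j
  exact congrFun₂ (h (i.1 + j.1) (by omega)) i.2 j.2

theorem hankelSchur_congr (h : ∀ j ≤ 2 * n, s j = s' j) : hankelSchur s n = hankelSchur s' n := by
  cases n with
  | zero => exact h 0 le_rfl
  | succ n =>
    have hrow : blockRow s (n + 1) n = blockRow s' (n + 1) n := by
      ext i j
      exact congrFun₂ (h (n + 1 + j.1) (by omega)) i j.2
    have hcol : blockCol s (n + 1) n = blockCol s' (n + 1) n := by
      ext i j
      exact congrFun₂ (h (n + 1 + i.1) (by omega)) i.2 j
    rw [hankelSchur, hankelSchur, h _ le_rfl, hrow, hcol,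
      blockHankel_congr fun j hj => h j (by omega)]

theorem HNonneg_congr (h : ∀ j ≤ 2 * n, s j = s' j) (hs : s ∈ HNonneg q n) : s' ∈ HNonneg q n := by
  have hH : (blockHankel s n).PosSemidef := hs
  rwa [blockHankel_congr h] at hH

theorem HPos_congr (h : ∀ j ≤ 2 * n, s j = s' j) (hs : s ∈ HPos q n) : s' ∈ HPos q n := by
  have hH : (blockHankel s n).PosDef := hs
  rwa [blockHankel_congr h] at hH

theorem HNonnegCD_congr (h : ∀ j ≤ 2 * n, s j = s' j) (hs : s ∈ HNonnegCD q n) :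
    s' ∈ HNonnegCD q n :=
  ⟨HNonneg_congr h hs.1, hankelSchur_congr h ▸ hs.2⟩

theorem KNonnegFin_congr (h : ∀ j ≤ m, s j = s' j) (hs : s ∈ KNonnegFin q α m) :
    s' ∈ KNonnegFin q α m := by
  refine ⟨HNonneg_congr (fun j hj => h j (by omega)) hs.1, fun hm => ?_⟩
  have hshift := hs.2 hm
  obtain ⟨m, rfl⟩ := Nat.exists_eq_add_of_le' hm
  exact HNonneg_congr (fun j hj => rightShift_congr (α : ℂ) h j (by omega)) hshift

theorem KPosFin_congr (h : ∀ j ≤ m, s j = s' j) (hs : s ∈ KPosFin q α m) :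
    s' ∈ KPosFin q α m := by
  refine ⟨HPos_congr (fun j hj => h j (by omega)) hs.1, fun hm => ?_⟩
  have hshift := hs.2 hm
  obtain ⟨m, rfl⟩ := Nat.exists_eq_add_of_le' hm
  exact HPos_congr (fun j hj => rightShift_congr (α : ℂ) h j (by omega)) hshift

theorem KNonnegCDFin_congr (h : ∀ j ≤ m, s j = s' j) (hs : s ∈ KNonnegCDFin q α m) :
    s' ∈ KNonnegCDFin q α m := by
  refine ⟨KNonnegFin_congr h hs.1, ?_, ?_⟩
  · rintro n rfl
    exact HNonnegCD_congr h (hs.2.1 n rfl)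
  · rintro n rfl
    exact HNonnegCD_congr (rightShift_congr (α : ℂ) h) (hs.2.2 n rfl)

theorem reciprocal_congr (h₀ : s 0 = s' 0)
    (h : ∀ j ≤ m, mpInv (s 0) * s j * mpInv (s 0) = mpInv (s 0) * s' j * mpInv (s 0))
    (j : ℕ) (hj : j ≤ m) : reciprocal s j = reciprocal s' j := by
  induction j using Nat.strong_induction_on with
  | _ j ih =>
    cases j with
    | zero => rw [reciprocal_zero, reciprocal_zero, h₀]
    | succ j =>
      rw [reciprocal_succ, reciprocal_succ, ← h₀, Finset.mul_sum, Finset.mul_sum]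
      refine congrArg _ (Finset.sum_congr rfl fun l hl => ?_)
      have hl := Finset.mem_range.mp hl
      rw [← ih l hl (by omega), reciprocal_eq_mpInv_mul_coeff_monicInverse]
      simp only [← Matrix.mul_assoc, h (j + 1 - l) (by omega)]

theorem rightShift_mul_mul (a : ℂ) (s : ℕ → Matrix (Fin q) (Fin q) ℂ)
    (P Q : Matrix (Fin q) (Fin q) ℂ) :
    rightShift a (fun j => P * s j * Q) = fun j => P * rightShift a s j * Q := by
  funext j
  simp only [rightShift, Matrix.mul_add, Matrix.add_mul, Matrix.mul_neg, Matrix.neg_mul,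
    Matrix.mul_smul, Matrix.smul_mul]

theorem plusTransform_mul_mul (a : ℂ) (s : ℕ → Matrix (Fin q) (Fin q) ℂ)
    (P Q : Matrix (Fin q) (Fin q) ℂ) :
    plusTransform a (fun j => P * s j * Q) = fun j => P * plusTransform a s j * Q := by
  funext j
  cases j with
  | zero => rfl
  | succ j => exact congrFun (rightShift_mul_mul a s P Q) j

theorem schurStieltjes_congr (a : ℂ) (h₀ : s 0 = s' 0)
    (h : ∀ j ≤ m + 1, mpInv (s 0) * s j * mpInv (s 0) = mpInv (s 0) * s' j * mpInv (s 0))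
    (j : ℕ) (hj : j ≤ m) : schurStieltjes a s j = schurStieltjes a s' j := by
  have hplus := plusTransform_congr a h
  rw [plusTransform_mul_mul, plusTransform_mul_mul] at hplus
  have hrec := reciprocal_congr (s := plusTransform a s) (s' := plusTransform a s') h₀ hplus
    (j + 1) (Nat.succ_le_succ hj)
  rw [schurStieltjes, schurStieltjes, shortReciprocal, shortReciprocal, hrec, h₀]

end Locality

section Compression

variable {q m n : ℕ} {s : ℕ → Matrix (Fin q) (Fin q) ℂ} {α : ℝ}

/-- The sequence `s` compressed to the range of `s 0` and cut off after index `m`, which makes it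
first-term dominant when `s 0, …, s m` are Hermitian. -/
noncomputable def compress (s : ℕ → Matrix (Fin q) (Fin q) ℂ) (m : ℕ) :
    ℕ → Matrix (Fin q) (Fin q) ℂ :=
  fun j => if j ≤ m then rangeProj (s 0) * s j * rangeProj (s 0) else 0

theorem compress_of_le {j : ℕ} (hj : j ≤ m) :
    compress s m j = rangeProj (s 0) * s j * rangeProj (s 0) :=
  if_pos hj

theorem compress_zero (h : (s 0).IsHermitian) : compress s m 0 = s 0 := by
  rw [compress_of_le m.zero_le, rangeProj_mul_self, mul_rangeProj_self h]

theorem isFirstTermDominant_compress (h : ∀ j ≤ m, (s j).IsHermitian) :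
    IsFirstTermDominant (compress s m) where
  isHermitian j := by
    rw [compress]
    split_ifs with hj
    · have hconj := isHermitian_mul_mul_conjTranspose (rangeProj (s 0)) (h j hj)
      rwa [isHermitian_rangeProj] at hconj
    · exact isHermitian_zero
  rangeProj_mul j := by
    rw [compress_zero (h 0 m.zero_le), compress, mul_ite, Matrix.mul_zero, ← Matrix.mul_assoc,
      ← Matrix.mul_assoc, rangeProj_mul_rangeProj]

theorem schurStieltjes_compress (a : ℂ) (h : (s 0).IsHermitian) (j : ℕ) (hj : j ≤ m) :
    schurStieltjes a (compress s (m + 1)) j = schurStieltjes a s j := by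
  refine schurStieltjes_congr a (compress_zero h) (fun i hi => ?_) j hj
  rw [compress_zero h, compress_of_le hi, ← Matrix.mul_assoc, ← Matrix.mul_assoc,
    mpInv_mul_rangeProj, Matrix.mul_assoc, rangeProj_mul_mpInv h]

theorem mul_mul_conjTranspose_mem_HNonneg (P : Matrix (Fin q) (Fin q) ℂ)
    (h : s ∈ HNonneg q n) : (fun j => P * s j * Pᴴ) ∈ HNonneg q n := by
  have heq : blockHankel (fun j => P * s j * Pᴴ) n =
      compRingEquiv _ _ _ (diagonal fun _ => P) * blockHankel s n *
        (compRingEquiv _ _ _ (diagonal fun _ => P))ᴴ := by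
    have hconj : (compRingEquiv (Fin (n + 1)) (Fin q) ℂ (diagonal fun _ => P))ᴴ =
      compRingEquiv _ _ _ (diagonal fun _ => P)ᴴ := rfl
    have hhankel : blockHankel s n = compRingEquiv _ _ _ (hankel s n) := rfl
    rw [hconj, hhankel, ← map_mul, ← map_mul, diagonal_conjTranspose]
    refine congrArg _ (Matrix.ext fun j k => ?_)
    rw [mul_diagonal, diagonal_mul]
    rfl
  have hpsd := PosSemidef.mul_mul_conjTranspose_same h
    (compRingEquiv (Fin (n + 1)) (Fin q) ℂ (diagonal fun _ => P))
  rwa [← heq] at hpsd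

theorem compress_mem_KNonnegFin (h : s ∈ KNonnegFin q α m) :
    compress s m ∈ KNonnegFin q α m := by
  have hP := isHermitian_rangeProj (s 0)
  refine KNonnegFin_congr (s := fun j => rangeProj (s 0) * s j * (rangeProj (s 0))ᴴ)
    (fun j hj => by rw [compress_of_le hj, hP]) ⟨mul_mul_conjTranspose_mem_HNonneg _ h.1, ?_⟩
  rw [rightShift_mul_mul]
  exact fun hm => mul_mul_conjTranspose_mem_HNonneg _ (h.2 hm)

theorem isHermitian_of_isHermitian_blockHankel (h : (blockHankel s n).IsHermitian) {j : ℕ}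
    (hj : j ≤ 2 * n) : (s j).IsHermitian := by
  obtain ⟨k, l, hk, hl, rfl⟩ : ∃ k l, k < n + 1 ∧ l < n + 1 ∧ j = k + l :=
    ⟨j / 2, j - j / 2, by omega, by omega, by omega⟩
  ext a b
  have hab := congrFun₂ h (⟨k, hk⟩, a) (⟨l, hl⟩, b)
  rw [conjTranspose_apply] at hab ⊢
  simpa only [blockHankel, Matrix.of_apply, Nat.add_comm l k] using hab

theorem isHermitian_of_mem_KNonnegFin (h : s ∈ KNonnegFin q α m) (j : ℕ) (hj : j ≤ m) :
    (s j).IsHermitian := by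
  rcases le_or_gt j (2 * (m / 2)) with hj' | hj'
  · exact isHermitian_of_isHermitian_blockHankel h.1.isHermitian hj'
  · obtain ⟨i, rfl⟩ := Nat.exists_eq_add_one.mpr (Nat.zero_lt_of_lt hj')
    have hi : (s i).IsHermitian :=
      isHermitian_of_isHermitian_blockHankel h.1.isHermitian (by omega)
    have hshift : (rightShift (α : ℂ) s i).IsHermitian :=
      isHermitian_of_isHermitian_blockHankel (h.2 (by omega)).isHermitian (by omega)
    have hα : IsSelfAdjoint (α : ℂ) := Complex.conj_ofReal α
    have heq : s (i + 1) = (α : ℂ) • s i + rightShift (α : ℂ) s i :=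
      (add_neg_cancel_left _ _).symm
    rw [heq]
    exact (hα.smul hi.isSelfAdjoint).add hshift

section Kernel

variable {E : Matrix (Fin q) (Fin q) ℂ}

theorem rightShift_mul_of_mul_eq_zero (a : ℂ) {j : ℕ} (h : s j * E = 0) :
    rightShift a s j * E = s (j + 1) * E := by
  rw [rightShift, Matrix.add_mul, Matrix.neg_mul, Matrix.smul_mul, h, smul_zero, neg_zero, zero_add]

theorem mul_eq_zero_of_mem_KNonnegFin (h : s ∈ KNonnegFin q α m) (hE : s 0 * E = 0) (j : ℕ)
    (hj : j < m) : s j * E = 0 := by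
  have heven := mul_eq_zero_of_zero_mul_eq_zero h.1 hE
  rcases lt_or_ge j (2 * (m / 2)) with hj' | hj'
  · exact heven j hj'
  obtain _ | i := j
  · exact hE
  rw [← rightShift_mul_of_mul_eq_zero α (heven i (by omega))]
  refine mul_eq_zero_of_zero_mul_eq_zero (h.2 (by omega)) ?_ i (by omega)
  rw [rightShift_mul_of_mul_eq_zero α hE]
  exact heven 1 (by omega)

theorem mul_eq_zero_of_mem_KNonnegCDFin (h : s ∈ KNonnegCDFin q α m) (hE : s 0 * E = 0) (j : ℕ)
    (hj : j ≤ m) : s j * E = 0 := by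
  have hlt := mul_eq_zero_of_mem_KNonnegFin h.1 hE
  rcases hj.lt_or_eq with hj | rfl
  · exact hlt j hj
  rcases j.even_or_odd' with ⟨n, rfl | rfl⟩
  · exact mul_eq_zero_of_hankelSchur_eq_zero (h.2.1 n rfl).2 hlt
  · rw [← rightShift_mul_of_mul_eq_zero α (hlt (2 * n) (by omega))]
    refine mul_eq_zero_of_hankelSchur_eq_zero (h.2.2 n rfl).2 fun i hi => ?_
    rw [rightShift_mul_of_mul_eq_zero α (hlt i (by omega)), hlt (i + 1) (by omega)]

end Kernel

theorem compress_of_mem_KNonnegCDFin (h : s ∈ KNonnegCDFin q α m) (j : ℕ) (hj : j ≤ m) :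
    compress s m j = s j := by
  have hherm := isHermitian_of_mem_KNonnegFin h.1
  have hright : s j * rangeProj (s 0) = s j := by
    have hE : s 0 * (1 - rangeProj (s 0)) = 0 := by
      rw [Matrix.mul_sub, Matrix.mul_one, mul_rangeProj_self (hherm 0 m.zero_le), sub_self]
    have hzero := mul_eq_zero_of_mem_KNonnegCDFin h hE j hj
    rw [Matrix.mul_sub, Matrix.mul_one, sub_eq_zero] at hzero
    exact hzero.symm
  have hleft := congrArg conjTranspose hright
  rw [conjTranspose_mul, isHermitian_rangeProj, hherm j hj] at hleft
  rw [compress_of_le hj, hleft, hright]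

theorem compress_of_mem_KPosFin (h : s ∈ KPosFin q α m) (j : ℕ) (hj : j ≤ m) :
    compress s m j = s j := by
  have hs₀ : (s 0).PosDef := h.1.submatrix (Prod.mk_right_injective 0)
  rw [compress_of_le hj, rangeProj_eq_one hs₀.isUnit, Matrix.one_mul, Matrix.mul_one]

end Compression

section Transform

variable {q m : ℕ} {s : ℕ → Matrix (Fin q) (Fin q) ℂ} {α : ℝ}

theorem schurStieltjes_mem_KNonnegFin (h : s ∈ KNonnegFin q α (m + 1)) :
    schurStieltjes (α : ℂ) s ∈ KNonnegFin q α m := by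
  have hherm := isHermitian_of_mem_KNonnegFin h
  exact KNonnegFin_congr (schurStieltjes_compress _ (hherm 0 (m + 1).zero_le))
    ((isFirstTermDominant_compress hherm).schurStieltjes_mem_KNonnegFin
      (compress_mem_KNonnegFin h))

theorem schurStieltjes_mem_KPosFin (h : s ∈ KPosFin q α (m + 1)) :
    schurStieltjes (α : ℂ) s ∈ KPosFin q α m := by
  have hherm := isHermitian_of_mem_KNonnegFin
    (⟨h.1.posSemidef, fun hm => (h.2 hm).posSemidef⟩ : s ∈ KNonnegFin q α (m + 1))
  have hcompress := KPosFin_congr (fun j hj => (compress_of_mem_KPosFin h j hj).symm) h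
  exact KPosFin_congr (schurStieltjes_compress _ (hherm 0 (m + 1).zero_le))
    ((isFirstTermDominant_compress hherm).schurStieltjes_mem_KPosFin hcompress)

theorem schurStieltjes_mem_KNonnegCDFin (h : s ∈ KNonnegCDFin q α (m + 1)) :
    schurStieltjes (α : ℂ) s ∈ KNonnegCDFin q α m := by
  have hherm := isHermitian_of_mem_KNonnegFin h.1
  have hcompress := KNonnegCDFin_congr (fun j hj => (compress_of_mem_KNonnegCDFin h j hj).symm) h
  exact KNonnegCDFin_congr (schurStieltjes_compress _ (hherm 0 (m + 1).zero_le))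
    ((isFirstTermDominant_compress hherm).schurStieltjes_mem_KNonnegCDFin hcompress)

theorem schurStieltjes_mem_KNonnegCDFin_pred (h : s ∈ KNonnegCDFin q α m) :
    schurStieltjes (α : ℂ) s ∈ KNonnegCDFin q α (m - 1) := by
  cases m with
  | zero =>
    have hs₀ : s 0 = 0 := (h.2.1 0 rfl).2
    refine KNonnegCDFin_congr (fun j hj => ?_) h
    rw [Nat.le_zero.mp hj, schurStieltjes, hs₀, Matrix.mul_zero]
  | succ m => exact schurStieltjes_mem_KNonnegCDFin h

theorem schurStieltjes_mem_KNonneg {κ : ℕ∞} (h : s ∈ KNonneg q α (κ + 1)) :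
    schurStieltjes (α : ℂ) s ∈ KNonneg q α κ := by
  cases κ with
  | top => exact fun m => schurStieltjes_mem_KNonnegFin (h (m + 1))
  | coe m => exact schurStieltjes_mem_KNonnegFin h

theorem schurStieltjes_mem_KNonnegExt {κ : ℕ∞} (h : s ∈ KNonnegExt q α (κ + 1)) :
    schurStieltjes (α : ℂ) s ∈ KNonnegExt q α κ := by
  cases κ with
  | top => exact schurStieltjes_mem_KNonneg (κ := ⊤) h
  | coe m =>
    obtain ⟨t, ht, hts⟩ := h
    refine ⟨schurStieltjes (α : ℂ) t, schurStieltjes_mem_KNonnegFin ht, ?_⟩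
    exact schurStieltjes_congr _ (hts 0 (m + 1).zero_le) fun j hj => by rw [hts j hj]

theorem schurStieltjes_mem_KPos {κ : ℕ∞} (h : s ∈ KPos q α (κ + 1)) :
    schurStieltjes (α : ℂ) s ∈ KPos q α κ := by
  cases κ with
  | top => exact fun m => schurStieltjes_mem_KPosFin (h (m + 1))
  | coe m => exact schurStieltjes_mem_KPosFin h

theorem schurStieltjes_mem_KNonnegCDAt {κ : ℕ∞} (h : s ∈ KNonnegCDAt q α (κ + 1) m) :
    schurStieltjes (α : ℂ) s ∈ KNonnegCDAt q α κ (m - 1) :=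
  ⟨schurStieltjes_mem_KNonneg h.1, schurStieltjes_mem_KNonnegCDFin_pred h.2⟩

theorem schurStieltjes_mem_KNonnegCD {κ : ℕ∞} (h : s ∈ KNonnegCD q α (κ + 1)) :
    schurStieltjes (α : ℂ) s ∈ KNonnegCD q α κ := by
  cases κ with
  | top =>
    obtain ⟨hs, m, hm⟩ := h
    exact ⟨schurStieltjes_mem_KNonneg (κ := ⊤) hs, m - 1, schurStieltjes_mem_KNonnegCDFin_pred hm⟩
  | coe m => exact schurStieltjes_mem_KNonnegCDFin h

end Transform

end StieltjesSeq

open StieltjesSeq in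
theorem theoremP1546 (q : ℕ) (hq : 1 ≤ q) (α : ℝ) (κ : ℕ∞) (hκ : 1 ≤ κ)
    (s : ℕ → Matrix (Fin q) (Fin q) ℂ) :
    (s ∈ StieltjesSeq.KNonneg q α κ →
      StieltjesSeq.schurStieltjes (α : ℂ) s ∈ StieltjesSeq.KNonneg q α (κ - 1)) ∧
    (s ∈ StieltjesSeq.KNonnegExt q α κ →
      StieltjesSeq.schurStieltjes (α : ℂ) s ∈ StieltjesSeq.KNonnegExt q α (κ - 1)) ∧
    (s ∈ StieltjesSeq.KPos q α κ →
      StieltjesSeq.schurStieltjes (α : ℂ) s ∈ StieltjesSeq.KPos q α (κ - 1)) ∧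
    (∀ m : ℕ, (m : ℕ∞) ≤ κ → s ∈ StieltjesSeq.KNonnegCDAt q α κ m →
      StieltjesSeq.schurStieltjes (α : ℂ) s ∈
        StieltjesSeq.KNonnegCDAt q α (κ - 1) (max 0 (m - 1))) ∧
    (s ∈ StieltjesSeq.KNonnegCD q α κ →
      StieltjesSeq.schurStieltjes (α : ℂ) s ∈ StieltjesSeq.KNonnegCD q α (κ - 1)) := by
  have hκ_succ : κ = κ - 1 + 1 := (tsub_add_cancel_of_le hκ).symm
  generalize κ - 1 = κ' at hκ_succ ⊢
  subst hκ_succ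
  simp only [Nat.zero_max]
  exact ⟨schurStieltjes_mem_KNonneg, schurStieltjes_mem_KNonnegExt, schurStieltjes_mem_KPos,
    fun _ _ => schurStieltjes_mem_KNonnegCDAt, schurStieltjes_mem_KNonnegCD⟩
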